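/- Let $d\ge 1$ and let $\Sigma\subset\mathbb{R}^d$ be a compact $C^\infty$-smooth embedded submanifold (without boundary) of dimension $d-1$. For a Schwartz function $f\in\mathcal{S}(\mathbb{R}^d)$ (complex valued) let $\hat f(\xi)=\int_{\mathbb{R}^d} f(x)e^{-2\pi i\langle x,\xi\rangle}\,dx$, and for $p\in[1,\infty]$ define $$ {}_{\Sigma}L_p=\operatorname{clos}_{L_p(\mathbb{R}^d)}\bigl\{f\in\mathcal{S}(\mathbb{R}^d)\;:\;\hat f(\xi)=0\ \text{ for all }\xi\in\Sigma\bigr\}. $$ Then for every $p\in\bigl(\tfrac{2d}{d+1},\infty\bigr)$ one has ${}_{\Sigma}L_p=L_p(\mathbb{R}^d)$. -/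

import Mathlib

open MeasureTheory
open scoped ENNReal ContDiff FourierTransform SchwartzMap

/-- A set `S ⊆ ℝ^d` is a `C^∞`-smooth hypersurface (embedded submanifold of codimension one,
without boundary): near each of its points it is the zero set of a smooth real function whose
differential does not vanish. -/
def IsSmoothHypersurface {d : ℕ} (S : Set (EuclideanSpace ℝ (Fin d))) : Prop :=
  ∀ x ∈ S, ∃ (U : Set (EuclideanSpace ℝ (Fin d))) (φ : EuclideanSpace ℝ (Fin d) → ℝ),
    IsOpen U ∧ x ∈ U ∧ ContDiffOn ℝ ∞ φ U ∧ (∀ y ∈ U, fderiv ℝ φ y ≠ 0) ∧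
      S ∩ U = {y ∈ U | φ y = 0}

/-- The complex Schwartz functions on `ℝ^d` whose Fourier transform
`ξ ↦ ∫ f(x) exp (-2π i ⟨x, ξ⟩) dx` vanishes at every point of `S`. -/
noncomputable def schwartzVanishing {d : ℕ} (S : Set (EuclideanSpace ℝ (Fin d))) :
    Submodule ℂ 𝓢(EuclideanSpace ℝ (Fin d), ℂ) where
  carrier := {f | ∀ ξ ∈ S, 𝓕 (f : EuclideanSpace ℝ (Fin d) → ℂ) ξ = 0}
  add_mem' := by
    intro f g hf hg ξ hξ
    have h := congrArg (fun u : 𝓢(EuclideanSpace ℝ (Fin d), ℂ) => u ξ)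
      (FourierTransform.fourier_add f g)
    simp only [add_apply, SchwartzMap.fourier_coe] at h
    rw [h, hf ξ hξ, hg ξ hξ, add_zero]
  zero_mem' := by
    intro ξ _
    simp [Real.fourier_eq]
  smul_mem' := by
    intro c f hf ξ hξ
    have h := congrArg (fun u : 𝓢(EuclideanSpace ℝ (Fin d), ℂ) => u ξ)
      (FourierTransform.fourier_smul c f)
    simp only [smul_apply, SchwartzMap.fourier_coe] at h
    rw [h, hf ξ hξ, smul_zero]

/-- The closure in `L_p(ℝ^d)` of the Schwartz functions whose Fourier transform vanishes
on `S`. -/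
noncomputable def vanishingLp {d : ℕ} (S : Set (EuclideanSpace ℝ (Fin d)))
    (p : ℝ≥0∞) [Fact (1 ≤ p)] :
    Submodule ℂ (Lp ℂ p (volume : Measure (EuclideanSpace ℝ (Fin d)))) :=
  ((schwartzVanishing S).map
    (SchwartzMap.toLpCLM ℂ ℂ p (volume : Measure (EuclideanSpace ℝ (Fin d)))).toLinearMap).topologicalClosure

/-! Suppose a Schwartz `G` has Fourier transform `1` on `S` and small `L_p` norm. Then the transform
of `f - f ⋆ G` vanishes on `S`, and Young's inequality bounds the error by `‖f‖_1 ‖G‖_p`. Density of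
Schwartz functions in `L_p` finishes the proof.

To build `G`, let `a` be a smooth cutoff equal to `1` on the `ε`-neighbourhood of `S` and `0` off
the `2ε`-neighbourhood, mollified at scale `ε`. Up to reflection, `G` is `𝓕 a` times `ψ (ε • ·)`.
The neighbourhood has volume `O(ε)`, so Plancherel gives `‖𝓕 a‖_2 = O(ε^(1/2))`. For `p ≤ 2`, Hölder
with `1/r = 1/p - 1/2` costs `ε^(-d/r)` for the dilate, and `1/2 - d(1/p - 1/2) > 0` is exactly `p >
2d/(d+1)`. For `p ≥ 2`, the bound `|𝓕 a| ≤ 1` gives `‖𝓕 a‖_p = O(ε^(1/p))`. -/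

/-! ### Volume of neighbourhoods of a hypersurface -/

theorem natCast_mul_measure_le_of_disjoint_translates {E : Type*} [NormedAddCommGroup E]
    [NormedSpace ℝ E] [MeasurableSpace E] [BorelSpace E] (μ : Measure E) [μ.IsAddRightInvariant]
    {A : Set E} (hA : MeasurableSet A) {x v : E} {R τ : ℝ} (hAR : A ⊆ Metric.ball x R)
    (hτ : 0 < τ) (h : ∀ y ∈ A, ∀ t ≥ τ, y + t • v ∉ A) (n : ℕ) (hn : n * τ ≤ 1) :
    n * μ A ≤ μ (Metric.ball x (R + ‖v‖)) := by
  -- `B k` is `A` translated by `kτ • v`; the first `n` of these are disjoint and stay in the larger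
  -- ball because `n * τ ≤ 1`.
  set B : ℕ → Set E := fun k => (fun y => y + (-(k * τ)) • v) ⁻¹' A with hB
  have hmeas : ∀ k, MeasurableSet (B k) := fun k => (measurable_add_const _) hA
  have hdisj : ∀ j k : ℕ, j < k → Disjoint (B j) (B k) := by
    intro j k hjk
    rw [Set.disjoint_left]
    intro y hj hk
    have hjk' : (j : ℝ) + 1 ≤ k := by exact_mod_cast hjk
    refine h _ hk ((k - j) * τ) (by nlinarith) ?_
    have : y + (-(k * τ)) • v + ((k - j) * τ) • v = y + (-(j * τ)) • v := by
      rw [add_assoc, ← add_smul]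
      congr 2
      ring
    rw [this]
    exact hj
  have hpair : Pairwise (Function.onFun Disjoint B) := by
    intro j k hjk
    rcases lt_or_gt_of_ne hjk with h | h
    · exact hdisj j k h
    · exact (hdisj k j h).symm
  calc (n : ℝ≥0∞) * μ A = ∑ k ∈ Finset.range n, μ (B k) := by
        simp [hB, measure_preimage_add_right]
    _ = μ (⋃ k ∈ Finset.range n, B k) :=
        (measure_biUnion_finset (fun j _ k _ hjk => hpair hjk) fun k _ => hmeas k).symm
    _ ≤ μ (Metric.ball x (R + ‖v‖)) := by
        refine measure_mono (Set.iUnion₂_subset fun k hk y hy => ?_)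
        have hkn : (k : ℝ) ≤ n := by exact_mod_cast (Finset.mem_range.1 hk).le
        have hk1 : (k : ℝ) * τ ≤ 1 := by nlinarith
        have hk0 : 0 ≤ (k : ℝ) * τ := by positivity
        have h1 := hAR hy
        rw [mem_ball_iff_norm] at h1 ⊢
        calc ‖y - x‖ = ‖(y + (-(k * τ)) • v - x) + (k * τ) • v‖ := by
              congr 1
              rw [neg_smul]
              abel
          _ ≤ ‖y + (-(k * τ)) • v - x‖ + ‖(k * τ) • v‖ := norm_add_le _ _
          _ < R + ‖v‖ := by
              rw [norm_smul, Real.norm_of_nonneg hk0]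
              nlinarith [norm_nonneg v]

/-- A set meeting every line of direction `v` in a piece of length less than `τ` has measure
`O(τ)`. -/
theorem measure_le_of_disjoint_translates {E : Type*} [NormedAddCommGroup E]
    [NormedSpace ℝ E] [MeasurableSpace E] [BorelSpace E] (μ : Measure E) [μ.IsAddRightInvariant]
    {A : Set E} (hA : MeasurableSet A) {x v : E} {R τ : ℝ} (hAR : A ⊆ Metric.ball x R)
    (hτ : 0 < τ) (hτ' : τ ≤ 1 / 2) (h : ∀ y ∈ A, ∀ t ≥ τ, y + t • v ∉ A) :
    μ A ≤ ENNReal.ofReal (2 * τ) * μ (Metric.ball x (R + ‖v‖)) := by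
  have hn : (⌊1 / τ⌋₊ : ℝ) * τ ≤ 1 := by
    have := Nat.floor_le (by positivity : 0 ≤ 1 / τ)
    calc (⌊1 / τ⌋₊ : ℝ) * τ ≤ 1 / τ * τ := by gcongr
      _ = 1 := by field_simp
  -- Rounding down loses at most a factor `2`, since `τ ≤ 1 / 2`.
  have hn2 : 1 ≤ 2 * τ * ⌊1 / τ⌋₊ := by
    have h1 := Nat.lt_floor_add_one (1 / τ)
    have h2 : 1 / τ * τ = 1 := by field_simp
    nlinarith
  calc μ A ≤ ENNReal.ofReal (2 * τ * ⌊1 / τ⌋₊) * μ A := by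
        refine le_mul_of_one_le_left' ?_
        rwa [ENNReal.one_le_ofReal]
    _ = ENNReal.ofReal (2 * τ) * (⌊1 / τ⌋₊ * μ A) := by
        rw [ENNReal.ofReal_mul (by positivity), ENNReal.ofReal_natCast, mul_assoc]
    _ ≤ _ := by
        gcongr
        exact natCast_mul_measure_le_of_disjoint_translates μ hA hAR hτ h _ hn

/-- Near `x`, `φ` grows at rate at least `c > 0` along a transversal direction `v`, while the
Lipschitz bound makes it `O(ε)` on the thickening. Lines along `v` therefore leave the thickening
after length `O(ε)`. -/
theorem exists_measure_thickening_zeroSet_le {E : Type*} [NormedAddCommGroup E]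
    [NormedSpace ℝ E] [FiniteDimensional ℝ E] [MeasurableSpace E] [BorelSpace E] (μ : Measure E)
    [μ.IsAddHaarMeasure] {φ : E → ℝ} {x : E} (hφ : ContDiffAt ℝ 1 φ x) (hx : fderiv ℝ φ x ≠ 0) :
    ∃ t ∈ nhds x, ∃ C ε₀ : ℝ, 0 < ε₀ ∧ 0 ≤ C ∧ ∀ ε, 0 < ε → ε ≤ ε₀ →
      μ (Metric.thickening ε (t ∩ {y | φ y = 0})) ≤ ENNReal.ofReal (C * ε) := by
  obtain ⟨v, hv⟩ : ∃ v, 0 < fderiv ℝ φ x v := by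
    obtain ⟨v, hv⟩ : ∃ v, fderiv ℝ φ x v ≠ 0 := by
      by_contra! h
      exact hx (ContinuousLinearMap.ext h)
    rcases lt_or_gt_of_ne hv with h | h
    · exact ⟨-v, by simpa using h⟩
    · exact ⟨v, h⟩
  obtain ⟨c, hc0, hc⟩ := exists_between hv
  have hcont : ContinuousAt (fun y => fderiv ℝ φ y v) x :=
    (hφ.continuousAt_fderiv (by simp)).clm_apply continuousAt_const
  have hder : ∀ᶠ y in nhds x, c < fderiv ℝ φ y v := hcont.eventually (lt_mem_nhds hc)
  obtain ⟨K, s, hs, hK⟩ := hφ.exists_lipschitzOnWith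
  obtain ⟨R, hR, hball⟩ := Metric.eventually_nhds_iff_ball.1
    (hder.and (Filter.eventually_of_mem hs fun y hy => hy))
  have hmvt : ∀ y ∈ Metric.ball x R, ∀ t : ℝ, 0 ≤ t → y + t • v ∈ Metric.ball x R →
      c * t ≤ φ (y + t • v) - φ y := by
    intro y hy t ht hyt
    obtain ⟨z, hz, hzeq⟩ := domain_mvt (f := φ) (f' := fun z => fderiv ℝ φ z)
      (s := Metric.ball x R) (fun z hz => by
        -- `fderiv` is `0` at points of non-differentiability, which `c < fderiv ℝ φ z v` rules out.
        refine DifferentiableAt.hasFDerivAt (by_contra fun h0 => ?_) |>.hasFDerivWithinAt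
        have := (hball z hz).1
        rw [fderiv_zero_of_not_differentiableAt h0, zero_apply] at this
        linarith)
      (convex_ball x R) hy hyt
    have hz' := (hball z ((convex_ball x R).segment_subset hy hyt hz)).1
    rw [hzeq, add_sub_cancel_left, map_smul, smul_eq_mul]
    nlinarith
  set L : ℝ := K + 1 with hL
  have hL0 : 0 < L := by positivity
  set M := (μ (Metric.ball x (R + ‖v‖))).toReal
  refine ⟨Metric.ball x (R / 2), Metric.ball_mem_nhds x (by positivity), 2 * (3 * L / c) * M,
    min (R / 2) (c / (6 * L)), by positivity, by positivity, fun ε hε hε' => ?_⟩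
  have hεR : ε ≤ R / 2 := hε'.trans (min_le_left _ _)
  have hεc : 3 * L / c * ε ≤ 1 / 2 := by
    calc 3 * L / c * ε ≤ 3 * L / c * (c / (6 * L)) := by
          gcongr
          exact hε'.trans (min_le_right _ _)
      _ = 1 / 2 := by field_simp; norm_num
  have hsub : ∀ y ∈ Metric.thickening ε (Metric.ball x (R / 2) ∩ {y | φ y = 0}),
      y ∈ Metric.ball x R ∧ |φ y| ≤ L * ε := by
    intro y hy
    obtain ⟨z, ⟨hzx, hz⟩, hyz⟩ := Metric.mem_thickening_iff.1 hy
    have hzR : z ∈ Metric.ball x R := Metric.ball_subset_ball (by linarith) hzx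
    have hyR : y ∈ Metric.ball x R := by
      rw [Metric.mem_ball] at hzx ⊢
      linarith [dist_triangle y z x]
    refine ⟨hyR, ?_⟩
    have h1 := hK.dist_le_mul y (hball y hyR).2 z (hball z hzR).2
    rw [Set.mem_ofPred_eq] at hz
    rw [hz, Real.dist_eq, sub_zero] at h1
    have hK0 : (0 : ℝ) ≤ K := K.2
    nlinarith [dist_nonneg (x := y) (y := z)]
  -- Two points of the thickening have `φ`-values at most `2Lε` apart, while a move by `t ≥ 3Lε/c`
  -- along `v` raises `φ` by at least `3Lε`.
  have hmain := measure_le_of_disjoint_translates μ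
    (A := Metric.thickening ε (Metric.ball x (R / 2) ∩ {y | φ y = 0}))
    Metric.isOpen_thickening.measurableSet (x := x) (v := v) (R := R) (τ := 3 * L / c * ε)
    (fun y hy => (hsub y hy).1) (by positivity) hεc (by
      intro y hy t ht hyt
      have ht0 : 0 ≤ t := le_trans (by positivity) ht
      have h1 := hmvt y (hsub y hy).1 t ht0 (hsub _ hyt).1
      have h2 := abs_le.1 (hsub y hy).2
      have h3 := abs_le.1 (hsub _ hyt).2
      have h4 : c * (3 * L / c * ε) = 3 * (L * ε) := by field_simp
      have h5 : c * (3 * L / c * ε) ≤ c * t := by gcongr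
      have h6 : 0 < L * ε := by positivity
      linarith [h2.1, h3.2])
  refine hmain.trans_eq ?_
  rw [← ENNReal.ofReal_toReal (measure_ball_lt_top (μ := μ)).ne,
    ← ENNReal.ofReal_mul (by positivity)]
  congr 1
  ring

/-- A compact hypersurface has finite upper Minkowski content. -/
theorem IsSmoothHypersurface.exists_volume_thickening_le {d : ℕ}
    {S : Set (EuclideanSpace ℝ (Fin d))} (hS' : IsSmoothHypersurface S) (hS : IsCompact S) :
    ∃ C ε₀ : ℝ, 0 < ε₀ ∧ 0 ≤ C ∧ ∀ ε, 0 < ε → ε ≤ ε₀ →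
      volume (Metric.thickening ε S) ≤ ENNReal.ofReal (C * ε) := by
  refine hS.induction_on (p := fun T => ∃ C ε₀ : ℝ, 0 < ε₀ ∧ 0 ≤ C ∧ ∀ ε, 0 < ε → ε ≤ ε₀ →
      volume (Metric.thickening ε T) ≤ ENNReal.ofReal (C * ε)) ?_ ?_ ?_ ?_
  · exact ⟨0, 1, one_pos, le_rfl, by simp⟩
  · rintro s t hst ⟨C, ε₀, h0, hC, h⟩
    exact ⟨C, ε₀, h0, hC, fun ε h1 h2 =>
      (measure_mono (Metric.thickening_subset_of_subset ε hst)).trans (h ε h1 h2)⟩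
  · rintro s t ⟨C, ε₀, h0, hC, h⟩ ⟨C', ε₀', h0', hC', h'⟩
    refine ⟨C + C', min ε₀ ε₀', lt_min h0 h0', add_nonneg hC hC', fun ε h1 h2 => ?_⟩
    rw [Metric.thickening_union, add_mul, ENNReal.ofReal_add (by positivity) (by positivity)]
    exact (measure_union_le _ _).trans (add_le_add (h ε h1 (h2.trans (min_le_left _ _)))
      (h' ε h1 (h2.trans (min_le_right _ _))))
  · intro x hx
    obtain ⟨U, φ, hU, hxU, hφ, hφ', hSU⟩ := hS' x hx
    have hat : ContDiffAt ℝ 1 φ x :=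
      ((hφ.contDiffAt (hU.mem_nhds hxU)).of_le (by exact_mod_cast le_top))
    obtain ⟨t, ht, C, ε₀, h0, hC, h⟩ :=
      exists_measure_thickening_zeroSet_le volume hat (hφ' x hxU)
    refine ⟨S ∩ (t ∩ U), Filter.inter_mem self_mem_nhdsWithin
      (mem_nhdsWithin_of_mem_nhds (Filter.inter_mem ht (hU.mem_nhds hxU))), C, ε₀, h0, hC,
      fun ε h1 h2 => (measure_mono (Metric.thickening_subset_of_subset ε ?_)).trans (h ε h1 h2)⟩
    rintro y ⟨hyS, hyt, hyU⟩
    exact ⟨hyt, (hSU.subset ⟨hyS, hyU⟩).2⟩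

/-! ### Young's inequality -/

/-- Hölder applied to `w * g = w^(1 - 1/p) * (w * g^p)^(1/p)`. -/
theorem ENNReal.lintegral_mul_rpow_le {α : Type*} [MeasurableSpace α] {μ : Measure α} {p : ℝ}
    (hp : 1 ≤ p) {w g : α → ℝ≥0∞} (hw : AEMeasurable w μ) (hg : AEMeasurable g μ) :
    (∫⁻ a, w a * g a ∂μ) ^ p ≤ (∫⁻ a, w a ∂μ) ^ (p - 1) * ∫⁻ a, w a * g a ^ p ∂μ := by
  have hp0 : 0 < p := one_pos.trans_le hp
  have h := ENNReal.lintegral_mul_norm_pow_le (μ := μ) (p := 1 - 1 / p) (q := 1 / p) hw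
    (hw.mul (hg.pow_const p)) (by rw [sub_nonneg, div_le_one hp0]; exact hp) (by positivity)
    (by ring)
  have heq : ∀ a, w a ^ (1 - 1 / p) * (w a * g a ^ p) ^ (1 / p) = w a * g a := by
    intro a
    rw [ENNReal.mul_rpow_of_nonneg _ _ (by positivity), ← ENNReal.rpow_mul, mul_one_div_cancel hp0.ne',
      ENNReal.rpow_one, ← mul_assoc, ← ENNReal.rpow_add_of_nonneg _ _
        (by rw [sub_nonneg, div_le_one hp0]; exact hp) (by positivity)]
    simp
  simp only [Pi.mul_apply, heq] at h
  calc (∫⁻ a, w a * g a ∂μ) ^ p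
      ≤ ((∫⁻ a, w a ∂μ) ^ (1 - 1 / p) * (∫⁻ a, w a * g a ^ p ∂μ) ^ (1 / p)) ^ p := by gcongr
    _ = _ := by
        rw [ENNReal.mul_rpow_of_nonneg _ _ hp0.le, ← ENNReal.rpow_mul, ← ENNReal.rpow_mul,
          one_div_mul_cancel hp0.ne', ENNReal.rpow_one, sub_mul, one_mul, one_div_mul_cancel hp0.ne']

/-- Young's inequality `‖f ⋆ g‖_p ≤ ‖f‖_1 ‖g‖_p` for Schwartz functions. -/
theorem SchwartzMap.eLpNorm_convolution_le {V : Type*} [NormedAddCommGroup V]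
    [InnerProductSpace ℝ V] [FiniteDimensional ℝ V] [MeasurableSpace V] [BorelSpace V]
    (f g : 𝓢(V, ℂ)) {p : ℝ≥0∞} (hp : 1 ≤ p) (hp' : p ≠ ⊤) :
    eLpNorm (convolution (ContinuousLinearMap.mul ℂ ℂ) f g) p volume ≤
      eLpNorm f 1 volume * eLpNorm g p volume := by
  have hp0 : p ≠ 0 := (one_pos.trans_le hp).ne'
  have hpr : 1 ≤ p.toReal := by
    simpa using ENNReal.toReal_mono hp' hp
  have hpr0 : 0 < p.toReal := one_pos.trans_le hpr
  have hpt : ∀ x, ‖convolution (ContinuousLinearMap.mul ℂ ℂ) f g x‖ₑ ≤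
      ∫⁻ t, ‖f t‖ₑ * ‖g (x - t)‖ₑ := by
    intro x
    rw [convolution_apply, MeasureTheory.convolution_def]
    refine (enorm_integral_le_lintegral_enorm _).trans_eq ?_
    simp [enorm_mul]
  rw [← ENNReal.rpow_le_rpow_iff hpr0, eLpNorm_eq_lintegral_rpow_enorm_toReal hp0 hp',
    ← ENNReal.rpow_mul, one_div_mul_cancel hpr0.ne', ENNReal.rpow_one,
    ENNReal.mul_rpow_of_nonneg _ _ hpr0.le, eLpNorm_eq_lintegral_rpow_enorm_toReal hp0 hp',
    ← ENNReal.rpow_mul, one_div_mul_cancel hpr0.ne', ENNReal.rpow_one, eLpNorm_one_eq_lintegral_enorm]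
  have hf : Continuous f := f.continuous
  have hg : Continuous g := g.continuous
  have hgm : Measurable g := hg.measurable
  calc ∫⁻ x, ‖convolution (ContinuousLinearMap.mul ℂ ℂ) f g x‖ₑ ^ p.toReal
      ≤ ∫⁻ x, (∫⁻ t, ‖f t‖ₑ) ^ (p.toReal - 1) * ∫⁻ t, ‖f t‖ₑ * ‖g (x - t)‖ₑ ^ p.toReal := by
        refine lintegral_mono fun x => ?_
        refine (ENNReal.rpow_le_rpow (hpt x) hpr0.le).trans ?_
        exact ENNReal.lintegral_mul_rpow_le hpr (by fun_prop) (by fun_prop)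
    _ = (∫⁻ t, ‖f t‖ₑ) ^ (p.toReal - 1) * ∫⁻ x, ∫⁻ t, ‖f t‖ₑ * ‖g (x - t)‖ₑ ^ p.toReal := by
        rw [lintegral_const_mul' _ _ (ENNReal.rpow_ne_top_of_nonneg (by linarith)
          (by simpa using (f.integrable (μ := volume)).2.ne))]
    _ = (∫⁻ t, ‖f t‖ₑ) ^ (p.toReal - 1) * ∫⁻ t, ∫⁻ x, ‖f t‖ₑ * ‖g (x - t)‖ₑ ^ p.toReal := by
        rw [lintegral_lintegral_swap]
        fun_prop
    _ = (∫⁻ t, ‖f t‖ₑ) ^ (p.toReal - 1) * ((∫⁻ t, ‖f t‖ₑ) * ∫⁻ x, ‖g x‖ₑ ^ p.toReal) := by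
        congr 1
        rw [← lintegral_mul_const _ (by fun_prop)]
        refine lintegral_congr fun t => ?_
        rw [lintegral_const_mul _ (by fun_prop)]
        congr 1
        exact lintegral_sub_right_eq_self (fun x => ‖g x‖ₑ ^ p.toReal) t
    _ = _ := by
        rw [← mul_assoc]
        congr 1
        conv_lhs => enter [2]; rw [← ENNReal.rpow_one (∫⁻ t, ‖f t‖ₑ)]
        rw [← ENNReal.rpow_add_of_nonneg _ _ (by linarith) (by linarith), sub_add_cancel]

/-! ### Cutoffs, dilations and the construction of `G` -/

section SchwartzDilation

variable {V : Type*} [NormedAddCommGroup V] [InnerProductSpace ℝ V]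

/-- The dilate `x ↦ ψ (ε • x)` of a Schwartz function. -/
noncomputable def SchwartzMap.dilate (ψ : 𝓢(V, ℂ)) (ε : ℝˣ) : 𝓢(V, ℂ) :=
  compCLMOfContinuousLinearEquiv ℂ (ContinuousLinearEquiv.smulLeft ε : V ≃L[ℝ] V) ψ

theorem SchwartzMap.dilate_apply (ψ : 𝓢(V, ℂ)) (ε : ℝˣ) (x : V) :
    ψ.dilate ε x = ψ ((ε : ℝ) • x) := rfl

theorem exists_schwartzMap_one_near [FiniteDimensional ℝ V] {S : Set V} (hS : IsCompact S) {ε : ℝ} (hε : 0 < ε) :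
    ∃ a : 𝓢(V, ℂ), (∀ ξ ∈ Metric.thickening ε S, a ξ = 1) ∧
      (∀ ξ ∉ Metric.thickening (2 * ε) S, a ξ = 0) ∧ ∀ ξ, ‖a ξ‖ ≤ 1 := by
  obtain ⟨f, hf0, hf1, hf⟩ := exists_contMDiffMap_zero_one_of_isClosed (n := (⊤ : ℕ∞))
    (modelWithCornersSelf ℝ V) (s := (Metric.thickening (2 * ε) S)ᶜ)
    (t := Metric.cthickening ε S) Metric.isOpen_thickening.isClosed_compl
    Metric.isClosed_cthickening (Set.disjoint_compl_left_iff_subset.2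
      (Metric.cthickening_subset_thickening' (by linarith) (by linarith) S))
  have hfs : ContDiff ℝ ∞ fun ξ => (f ξ : ℂ) :=
    Complex.ofRealCLM.contDiff.comp f.contMDiff.contDiff
  have hsupp : HasCompactSupport fun ξ => (f ξ : ℂ) := by
    refine HasCompactSupport.of_support_subset_isCompact
      (hS.cthickening (r := 2 * ε)) fun ξ hξ => ?_
    by_contra h
    refine hξ ?_
    have : f ξ = 0 := hf0 fun h' => h (Metric.thickening_subset_cthickening _ _ h')
    simp [this]
  refine ⟨hsupp.toSchwartzMap hfs, fun ξ hξ => ?_, fun ξ hξ => ?_, fun ξ => ?_⟩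
  · have : f ξ = 1 := hf1 (Metric.thickening_subset_cthickening _ _ hξ)
    simp [this]
  · have : f ξ = 0 := hf0 hξ
    simp [this]
  · have := hf ξ
    simpa [abs_of_nonneg this.1] using this.2

variable [FiniteDimensional ℝ V] [MeasurableSpace V] [BorelSpace V]

theorem SchwartzMap.eLpNorm_dilate (ψ : 𝓢(V, ℂ)) (ε : ℝˣ) (r : ℝ≥0∞) :
    eLpNorm (ψ.dilate ε) r volume =
      ENNReal.ofReal |((ε : ℝ) ^ Module.finrank ℝ V)⁻¹| ^ (1 / r).toReal * eLpNorm ψ r volume := by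
  have h : eLpNorm ψ r (Measure.map (fun x => (ε : ℝ) • x) volume) =
      eLpNorm (ψ.dilate ε) r volume :=
    eLpNorm_map_measure ψ.continuous.aestronglyMeasurable (by fun_prop)
  rw [← h, show (fun x : V => (ε : ℝ) • x) = ((ε : ℝ) • ·) from rfl,
    Measure.map_addHaar_smul volume ε.ne_zero, eLpNorm_smul_measure_of_ne_zero (by simp),
    smul_eq_mul]

theorem SchwartzMap.fourierInv_dilate (ψ : 𝓢(V, ℂ)) (ε : ℝˣ) (ξ : V) :
    𝓕⁻ (ψ.dilate ε) ξ =
      (|((ε : ℝ) ^ Module.finrank ℝ V)⁻¹| : ℝ) • 𝓕⁻ ψ ((ε⁻¹ : ℝ) • ξ) := by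
  rw [fourierInv_coe, fourierInv_coe, Real.fourierInv_eq, Real.fourierInv_eq,
    ← Measure.integral_comp_smul]
  refine integral_congr_ae (.of_forall fun x => ?_)
  simp only [dilate_apply, inner_smul_left, inner_smul_right]
  simp

/-- Approximate identities whose Fourier transforms are the dilates of a single function. -/
theorem exists_schwartzMap_approximate_identity (V : Type*) [NormedAddCommGroup V]
    [InnerProductSpace ℝ V] [FiniteDimensional ℝ V] [MeasurableSpace V] [BorelSpace V] :
    ∃ ψ : 𝓢(V, ℂ), ∀ ε : ℝˣ, 0 < (ε : ℝ) →
      (∀ ξ, (ε : ℝ) ≤ ‖ξ‖ → 𝓕⁻ (ψ.dilate ε) ξ = 0) ∧ ∫ ξ, (𝓕⁻ (ψ.dilate ε) : 𝓢(V, ℂ)) ξ = 1 := by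
  let b : ContDiffBump (0 : V) := ⟨1 / 2, 1, by norm_num, by norm_num⟩
  have hbs : HasCompactSupport fun ξ => (b.normed volume ξ : ℂ) :=
    (b.hasCompactSupport_normed (μ := volume)).comp_left (g := ((↑) : ℝ → ℂ)) (by simp)
  have hbd : ContDiff ℝ ∞ fun ξ => (b.normed volume ξ : ℂ) :=
    Complex.ofRealCLM.contDiff.comp b.contDiff_normed
  set ρ : 𝓢(V, ℂ) := hbs.toSchwartzMap hbd
  have hρ : ∀ ξ, ρ ξ = (b.normed volume ξ : ℂ) := fun ξ => rfl
  -- With `ψ = 𝓕 ρ`, the inverse transform of the dilate is the rescaled bump `ε^(-n) ρ(ξ/ε)`; its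
  -- integral is `ψ 0`, unaffected by dilation.
  refine ⟨𝓕 ρ, fun ε hε => ⟨fun ξ hξ => ?_, ?_⟩⟩
  · have hb : b.normed volume ((ε⁻¹ : ℝ) • ξ) = 0 := by
      rw [← Function.notMem_support, b.support_normed_eq, mem_ball_zero_iff, norm_smul, not_lt,
        norm_inv, Real.norm_of_nonneg hε.le]
      change 1 ≤ _
      rw [inv_mul_eq_div, one_le_div hε]
      exact hξ
    rw [SchwartzMap.fourierInv_dilate, FourierTransform.fourierInv_fourier_eq, hρ, hb]
    simp
  · calc ∫ ξ, (𝓕⁻ ((𝓕 ρ).dilate ε) : 𝓢(V, ℂ)) ξ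
        = (𝓕 (𝓕⁻ ((𝓕 ρ).dilate ε) : 𝓢(V, ℂ)) : 𝓢(V, ℂ)) 0 := by
          rw [SchwartzMap.fourier_coe, Real.fourier_eq]
          simp
      _ = (𝓕 ρ : 𝓢(V, ℂ)) 0 := by
          rw [FourierTransform.fourier_fourierInv_eq, SchwartzMap.dilate_apply, smul_zero]
      _ = ∫ ξ, (b.normed volume ξ : ℂ) := by
          rw [SchwartzMap.fourier_coe, Real.fourier_eq]
          simp [hρ]
      _ = 1 := by
          rw [integral_complex_ofReal, b.integral_normed, Complex.ofReal_one]

/-- For `a = 1` near `S` and an approximate identity `ρ` at that scale, `a ⋆ ρ = 1` on `S`. -/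
theorem SchwartzMap.convolution_eq_one {a ρ : 𝓢(V, ℂ)} {S : Set V} {ε : ℝ}
    (ha : ∀ ξ ∈ Metric.thickening ε S, a ξ = 1) (hρ : ∀ ξ, ε ≤ ‖ξ‖ → ρ ξ = 0)
    (hρ1 : ∫ ξ, ρ ξ = 1) {ξ : V} (hξ : ξ ∈ S) :
    convolution (ContinuousLinearMap.mul ℂ ℂ) a ρ ξ = 1 := by
  rw [convolution_apply, MeasureTheory.convolution_def, ← hρ1,
    ← integral_sub_left_eq_self (fun η => ρ η) volume ξ]
  refine integral_congr_ae (.of_forall fun t => ?_)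
  simp only [ContinuousLinearMap.mul_apply']
  rcases le_or_gt ε ‖ξ - t‖ with h | h
  · rw [hρ _ h, mul_zero]
  · rw [ha t (Metric.mem_thickening_iff.2 ⟨ξ, hξ, by rwa [dist_comm, dist_eq_norm]⟩), one_mul]

theorem SchwartzMap.eLpNorm_fourierInv (f : 𝓢(V, ℂ)) (p : ℝ≥0∞) :
    eLpNorm (𝓕⁻ f : 𝓢(V, ℂ)) p volume = eLpNorm (𝓕 f : 𝓢(V, ℂ)) p volume := by
  rw [fourierInv_apply_eq, compCLMOfContinuousLinearEquiv_apply]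
  exact eLpNorm_comp_measurePreserving (𝓕 f : 𝓢(V, ℂ)).continuous.aestronglyMeasurable
    (Measure.measurePreserving_neg volume)

theorem SchwartzMap.eLpNorm_two_fourier (f : 𝓢(V, ℂ)) :
    eLpNorm (𝓕 f : 𝓢(V, ℂ)) 2 volume = eLpNorm f 2 volume := by
  have h1 : (eLpNorm (𝓕 f : 𝓢(V, ℂ)) 2 volume).toReal = (eLpNorm f 2 volume).toReal :=
    norm_toLp.symm.trans ((norm_fourier_toL2_eq f).trans norm_toLp)
  have h2 : eLpNorm (𝓕 f : 𝓢(V, ℂ)) 2 volume ≠ ⊤ := ((𝓕 f : 𝓢(V, ℂ)).memLp 2 volume).eLpNorm_ne_top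
  have h3 : eLpNorm f 2 volume ≠ ⊤ := (f.memLp 2 volume).eLpNorm_ne_top
  rw [← ENNReal.ofReal_toReal h2, ← ENNReal.ofReal_toReal h3, h1]

theorem eLpNorm_rpow_le_of_norm_le_one {α : Type*} [MeasurableSpace α] {μ : Measure α}
    {f : α → ℂ} (hf : ∀ x, ‖f x‖ ≤ 1) {p : ℝ≥0∞} (hp : 2 ≤ p) (hp' : p ≠ ⊤) :
    eLpNorm f p μ ≤ eLpNorm f 2 μ ^ (2 / p.toReal) := by
  have hp0 : p ≠ 0 := (two_pos.trans_le hp).ne'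
  have hpr : 2 ≤ p.toReal := by simpa using ENNReal.toReal_mono hp' hp
  rw [eLpNorm_eq_lintegral_rpow_enorm_toReal hp0 hp',
    eLpNorm_eq_lintegral_rpow_enorm_toReal (by norm_num) (by norm_num), ← ENNReal.rpow_mul]
  have : (1 / (2 : ℝ≥0∞).toReal) * (2 / p.toReal) = 1 / p.toReal := by
    simp only [ENNReal.toReal_ofNat]
    field_simp
  rw [this]
  refine ENNReal.rpow_le_rpow (lintegral_mono fun x => ?_) (by positivity)
  refine ENNReal.rpow_le_rpow_of_exponent_ge ?_ (by simpa using hpr)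
  rw [← ofReal_norm]
  exact ENNReal.ofReal_le_one.2 (hf x)

/-- The function `G` constructed here has `𝓕 G = 1` on `S`, and up to a reflection it is the
product of the Fourier transform of a smooth indicator of the `2 * ε`-neighbourhood of `S` and a
dilate of `ψ`. -/
theorem exists_fourier_eq_one_eLpNorm_le {S : Set V} (hS : IsCompact S) {ψ : 𝓢(V, ℂ)} {ε : ℝˣ}
    (hε : 0 < (ε : ℝ)) (hψ : ∀ ξ, (ε : ℝ) ≤ ‖ξ‖ → 𝓕⁻ (ψ.dilate ε) ξ = 0)
    (hψ1 : ∫ ξ, (𝓕⁻ (ψ.dilate ε) : 𝓢(V, ℂ)) ξ = 1) :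
    ∃ a G : 𝓢(V, ℂ), (∀ ξ ∈ S, 𝓕 G ξ = 1) ∧
      eLpNorm (𝓕 a : 𝓢(V, ℂ)) 2 volume ≤ volume (Metric.thickening (2 * (ε : ℝ)) S) ^ (1 / 2 : ℝ) ∧
      (∀ ξ, ‖𝓕 a ξ‖ₑ ≤ volume (Metric.thickening (2 * (ε : ℝ)) S)) ∧
      ∀ (p q r : ℝ≥0∞) [ENNReal.HolderTriple q r p],
        eLpNorm G p volume ≤ eLpNorm (𝓕 a : 𝓢(V, ℂ)) q volume * eLpNorm (ψ.dilate ε) r volume := by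
  obtain ⟨a, ha1, ha0, ha⟩ := exists_schwartzMap_one_near hS hε
  have hind : ∀ ξ, ‖a ξ‖ₑ ≤
      ‖(Metric.thickening (2 * (ε : ℝ)) S).indicator (fun _ => (1 : ℂ)) ξ‖ₑ := by
    intro ξ
    by_cases hξ : ξ ∈ Metric.thickening (2 * (ε : ℝ)) S
    · rw [Set.indicator_of_mem hξ, enorm_one, ← ofReal_norm]
      exact ENNReal.ofReal_le_one.2 (ha ξ)
    · simp [ha0 ξ hξ]
  have hmeas : MeasurableSet (Metric.thickening (2 * (ε : ℝ)) S) :=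
    Metric.isOpen_thickening.measurableSet
  refine ⟨a, 𝓕⁻ (SchwartzMap.convolution (ContinuousLinearMap.mul ℂ ℂ) a (𝓕⁻ (ψ.dilate ε))),
    fun ξ hξ => ?_, ?_, fun ξ => ?_, fun p q r _ => ?_⟩
  · rw [FourierTransform.fourier_fourierInv_eq]
    exact SchwartzMap.convolution_eq_one ha1 hψ hψ1 hξ
  · rw [SchwartzMap.eLpNorm_two_fourier]
    refine (eLpNorm_mono_enorm hind).trans ?_
    rw [eLpNorm_indicator_const hmeas (by norm_num) (by norm_num)]
    simp
  · rw [SchwartzMap.fourier_coe, Real.fourier_eq]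
    refine (enorm_integral_le_lintegral_enorm _).trans ?_
    calc ∫⁻ v, ‖Real.fourierChar (-inner ℝ v ξ) • a v‖ₑ = ∫⁻ v, ‖a v‖ₑ := by
          refine lintegral_congr fun v => ?_
          rw [← ofReal_norm, Circle.norm_smul, ofReal_norm]
      _ ≤ ∫⁻ v, (Metric.thickening (2 * (ε : ℝ)) S).indicator (fun _ => 1) v := by
          refine lintegral_mono fun v => (hind v).trans_eq ?_
          rw [enorm_indicator_eq_indicator_enorm]
          simp
      _ = _ := by simp [lintegral_indicator hmeas]
  · rw [SchwartzMap.eLpNorm_fourierInv, SchwartzMap.fourier_convolution,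
      FourierTransform.fourier_fourierInv_eq]
    have h : (SchwartzMap.pairing (ContinuousLinearMap.mul ℂ ℂ) (𝓕 a) (ψ.dilate ε) : V → ℂ) =
        ((𝓕 a : 𝓢(V, ℂ)) : V → ℂ) • (ψ.dilate ε : V → ℂ) := by
      funext x
      rw [SchwartzMap.pairing_apply_apply]
      rfl
    rw [h]
    exact eLpNorm_smul_le_mul_eLpNorm (ψ.dilate ε).continuous.aestronglyMeasurable
      (𝓕 a : 𝓢(V, ℂ)).continuous.aestronglyMeasurable

end SchwartzDilation

/-! ### Smallness of `G` as `ε` tends to `0` -/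

theorem tendsto_ofReal_mul_rpow_mul_zero {c t : ℝ} (ht : 0 < t) {K : ℝ≥0∞} (hK : K ≠ ⊤) :
    Filter.Tendsto (fun ε : ℝ => ENNReal.ofReal (c * ε ^ t) * K) (nhdsWithin 0 (Set.Ioi 0))
      (nhds 0) := by
  have h1 : Filter.Tendsto (fun ε : ℝ => c * ε ^ t) (nhds 0) (nhds 0) := by
    have := ((Real.continuousAt_rpow_const 0 t (Or.inr ht.le)).const_mul c).tendsto
    simpa [Real.zero_rpow ht.ne'] using this
  have h2 := ENNReal.Tendsto.mul_const (b := K)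
    (ENNReal.tendsto_ofReal (h1.mono_left (nhdsWithin_le_nhds (s := Set.Ioi 0)))) (Or.inr hK)
  simpa using h2

/-- If the neighbourhoods of `S` have measure `O(ε)`, then the constant `1` on `S` extends to the
Fourier transform of a Schwartz function of small `L_p` norm. -/
theorem exists_fourier_eq_one_eLpNorm_lt {V : Type*} [NormedAddCommGroup V]
    [InnerProductSpace ℝ V] [FiniteDimensional ℝ V] [MeasurableSpace V] [BorelSpace V]
    {S : Set V} (hS : IsCompact S) {C ε₀ : ℝ} (hε₀ : 0 < ε₀) (hC : 0 ≤ C)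
    (hvol : ∀ ε, 0 < ε → ε ≤ ε₀ → volume (Metric.thickening ε S) ≤ ENNReal.ofReal (C * ε))
    {p : ℝ≥0∞} (hp1 : 1 ≤ p) (hp' : p ≠ ⊤)
    (hp : Module.finrank ℝ V * (1 / p.toReal - 1 / 2) < 1 / 2) {δ : ℝ≥0∞} (hδ : 0 < δ) :
    ∃ G : 𝓢(V, ℂ), (∀ ξ ∈ S, 𝓕 G ξ = 1) ∧ eLpNorm G p volume < δ := by
  obtain ⟨ψ, hψ⟩ := exists_schwartzMap_approximate_identity V
  set n := Module.finrank ℝ V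
  have hpr : 1 ≤ p.toReal := by simpa using ENNReal.toReal_mono hp' hp1
  have hsmall : ∀ᶠ ε in nhdsWithin (0 : ℝ) (Set.Ioi 0), 2 * ε < ε₀ ∧ C * (2 * ε) < 1 := by
    refine nhdsWithin_le_nhds (Filter.Eventually.and ?_ ?_)
    · exact (Continuous.tendsto' (by fun_prop) _ _ (by simp)).eventually (gt_mem_nhds hε₀)
    · exact (Continuous.tendsto' (by fun_prop) _ _ (by simp)).eventually (gt_mem_nhds one_pos)
  rcases le_total p 2 with hp2 | hp2
  -- Case `p ≤ 2`: `r` is the Hölder partner of `2`, with `r = ⊤` at `p = 2`.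
  · obtain ⟨r, hr⟩ : ∃ r : ℝ≥0∞, r⁻¹ = p⁻¹ - 2⁻¹ := ⟨(p⁻¹ - 2⁻¹)⁻¹, inv_inv _⟩
    have hle : (2 : ℝ≥0∞)⁻¹ ≤ p⁻¹ := ENNReal.inv_le_inv.2 hp2
    have : ENNReal.HolderTriple 2 r p := ⟨by rw [hr, add_tsub_cancel_of_le hle]⟩
    have hs : (1 / r).toReal = 1 / p.toReal - 1 / 2 := by
      rw [one_div, hr, ENNReal.toReal_sub_of_le hle (by simp; positivity)]
      simp
    have hlim := tendsto_ofReal_mul_rpow_mul_zero (c := (C * 2) ^ (1 / 2 : ℝ))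
      (t := 1 / 2 - n * (1 / p.toReal - 1 / 2)) (by linarith)
      (K := eLpNorm ψ r volume) (ψ.memLp r volume).eLpNorm_ne_top
    obtain ⟨ε, ⟨hlt, hεε₀, -⟩, hε⟩ := ((hlim.eventually (gt_mem_nhds hδ)).and hsmall |>.and
      self_mem_nhdsWithin).exists
    have hε0 : 0 < ε := hε
    lift ε to ℝˣ using hε0.ne'.isUnit
    obtain ⟨a, G, hG, ha2, -, hGp⟩ := exists_fourier_eq_one_eLpNorm_le hS hε0 (hψ ε hε0).1
      (hψ ε hε0).2
    refine ⟨G, hG, lt_of_le_of_lt ?_ hlt⟩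
    calc eLpNorm G p volume
        ≤ eLpNorm (𝓕 a : 𝓢(V, ℂ)) 2 volume * eLpNorm (ψ.dilate ε) r volume := hGp p 2 r
      _ ≤ ENNReal.ofReal (C * (2 * ε)) ^ (1 / 2 : ℝ) *
          (ENNReal.ofReal |((ε : ℝ) ^ n)⁻¹| ^ (1 / r).toReal * eLpNorm ψ r volume) := by
          rw [SchwartzMap.eLpNorm_dilate]
          gcongr
          exact ha2.trans (ENNReal.rpow_le_rpow (hvol _ (by positivity) hεε₀.le) (by norm_num))
      _ = ENNReal.ofReal ((C * 2) ^ (1 / 2 : ℝ) *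
          (ε : ℝ) ^ (1 / 2 - n * (1 / p.toReal - 1 / 2))) * eLpNorm ψ r volume := by
          have hs0 : 0 ≤ (1 / r).toReal := ENNReal.toReal_nonneg
          rw [← mul_assoc, ENNReal.ofReal_rpow_of_nonneg (by positivity) (by norm_num),
            ENNReal.ofReal_rpow_of_nonneg (by positivity) hs0,
            ← ENNReal.ofReal_mul (by positivity)]
          congr 2
          rw [abs_of_pos (by positivity), ← mul_assoc, Real.mul_rpow (by positivity) hε0.le,
            Real.rpow_sub hε0, Real.rpow_mul hε0.le, ← hs, Real.inv_rpow (by positivity),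
            Real.rpow_natCast]
          ring
  -- Case `p ≥ 2`: the sup norm of `ψ` is dilation invariant, and `C * (2 * ε) < 1` forces `|𝓕 a| ≤
  -- 1`.
  · have hlim := tendsto_ofReal_mul_rpow_mul_zero (c := (C * 2) ^ (1 / p.toReal))
      (t := 1 / p.toReal) (by positivity) (K := eLpNorm ψ ⊤ volume) (ψ.memLp ⊤ volume).eLpNorm_ne_top
    obtain ⟨ε, ⟨hlt, hεε₀, hε1⟩, hε⟩ := ((hlim.eventually (gt_mem_nhds hδ)).and hsmall |>.and
      self_mem_nhdsWithin).exists
    have hε0 : 0 < ε := hε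
    lift ε to ℝˣ using hε0.ne'.isUnit
    obtain ⟨a, G, hG, ha2, ha1, hGp⟩ := exists_fourier_eq_one_eLpNorm_le hS hε0 (hψ ε hε0).1
      (hψ ε hε0).2
    have hv := hvol (2 * (ε : ℝ)) (by positivity) hεε₀.le
    have hnorm : ∀ ξ, ‖(𝓕 a : 𝓢(V, ℂ)) ξ‖ ≤ 1 := by
      intro ξ
      have h := (ha1 ξ).trans (hv.trans (ENNReal.ofReal_le_one.2 hε1.le))
      rwa [← ofReal_norm, ENNReal.ofReal_le_one] at h
    refine ⟨G, hG, lt_of_le_of_lt ?_ hlt⟩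
    calc eLpNorm G p volume
        ≤ eLpNorm (𝓕 a : 𝓢(V, ℂ)) p volume * eLpNorm (ψ.dilate ε) ⊤ volume := hGp p p ⊤
      _ ≤ (ENNReal.ofReal (C * (2 * ε)) ^ (1 / 2 : ℝ)) ^ (2 / p.toReal) *
          eLpNorm ψ ⊤ volume := by
          rw [SchwartzMap.eLpNorm_dilate]
          simp only [ENNReal.div_top, ENNReal.toReal_zero, ENNReal.rpow_zero, one_mul]
          gcongr
          refine (eLpNorm_rpow_le_of_norm_le_one hnorm hp2 hp').trans ?_
          gcongr
          exact ha2.trans (ENNReal.rpow_le_rpow hv (by norm_num))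
      _ = ENNReal.ofReal ((C * 2) ^ (1 / p.toReal) * (ε : ℝ) ^ (1 / p.toReal)) *
          eLpNorm ψ ⊤ volume := by
          rw [← ENNReal.rpow_mul, ENNReal.ofReal_rpow_of_nonneg (by positivity) (by positivity),
            ← mul_assoc, Real.mul_rpow (by positivity) hε0.le]
          congr 4 <;> ring

/-! ### Correction by convolution and conclusion -/

theorem SchwartzMap.fourier_sub_convolution_eq_zero {V : Type*} [NormedAddCommGroup V]
    [InnerProductSpace ℝ V] [FiniteDimensional ℝ V] [MeasurableSpace V] [BorelSpace V]
    (f G : 𝓢(V, ℂ)) {ξ : V} (hG : 𝓕 G ξ = 1) :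
    𝓕 (f - convolution (ContinuousLinearMap.mul ℂ ℂ) f G : 𝓢(V, ℂ)) ξ = 0 := by
  have h := FourierTransform.fourier_add
    (f - convolution (ContinuousLinearMap.mul ℂ ℂ) f G) (convolution (ContinuousLinearMap.mul ℂ ℂ) f G)
  rw [sub_add_cancel] at h
  rw [eq_sub_of_add_eq h.symm, fourier_convolution, sub_apply, pairing_apply_apply,
    ContinuousLinearMap.mul_apply', hG, mul_one, sub_self]

theorem mainTheorem1 (d : ℕ) (hd : 1 ≤ d) (S : Set (EuclideanSpace ℝ (Fin d)))
    (hS : IsCompact S) (hS' : IsSmoothHypersurface S)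
    (p : ℝ≥0∞) [Fact (1 ≤ p)] (hp : 2 * (d : ℝ≥0∞) / ((d : ℝ≥0∞) + 1) < p) (hp' : p ≠ ⊤) :
    vanishingLp S p = ⊤ := by
  have hp1 : 1 ≤ p := Fact.out
  have hpr : 1 ≤ p.toReal := by simpa using ENNReal.toReal_mono hp' hp1
  have hexp : Module.finrank ℝ (EuclideanSpace ℝ (Fin d)) * (1 / p.toReal - 1 / 2) < 1 / 2 := by
    have h := (ENNReal.toReal_lt_toReal hp.ne_top hp').2 hp
    rw [ENNReal.toReal_div, ENNReal.toReal_mul, ENNReal.toReal_add (by simp) (by simp)] at h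
    simp only [ENNReal.toReal_ofNat, ENNReal.toReal_natCast, ENNReal.toReal_one] at h
    rw [div_lt_iff₀ (by positivity)] at h
    rw [finrank_euclideanSpace_fin]
    have h2 : (d : ℝ) * (1 / p.toReal) < (d + 1) / 2 := by
      rw [mul_one_div, div_lt_iff₀ (by positivity)]
      linarith
    linarith
  obtain ⟨C, ε₀, hε₀, hC, hvol⟩ := hS'.exists_volume_thickening_le hS
  -- As the target is closed and Schwartz functions are dense (`p ≠ ⊤`), approximating each Schwartz
  -- `f` suffices.
  rw [← SetLike.coe_set_eq, Submodule.top_coe, ← Set.univ_subset_iff,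
    ← (SchwartzMap.denseRange_toLpCLM (F := ℂ) (p := p)
      (μ := (volume : Measure (EuclideanSpace ℝ (Fin d)))) hp').closure_range]
  refine closure_minimal ?_ (Submodule.isClosed_topologicalClosure _)
  rintro _ ⟨f, rfl⟩
  refine EMetric.mem_closure_iff.2 fun δ hδ => ?_
  have hf : eLpNorm f 1 volume ≠ ⊤ := (f.memLp 1 volume).eLpNorm_ne_top
  obtain ⟨δ', hδ', hlt⟩ := ENNReal.exists_pos_mul_lt hf hδ.ne'
  obtain ⟨G, hG, hGp⟩ := exists_fourier_eq_one_eLpNorm_lt hS hε₀ hC hvol hp1 hp' hexp hδ'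
  set g := f - SchwartzMap.convolution (ContinuousLinearMap.mul ℂ ℂ) f G with hg
  have hgS : g ∈ schwartzVanishing S := fun ξ hξ => f.fourier_sub_convolution_eq_zero G (hG ξ hξ)
  refine ⟨g.toLp p volume, Submodule.mem_map_of_mem hgS, ?_⟩
  have hfg : edist (f.toLp p volume) (g.toLp p volume) =
      eLpNorm (SchwartzMap.convolution (ContinuousLinearMap.mul ℂ ℂ) f G) p volume := by
    refine (Lp.edist_toLp_toLp _ _ _ _).trans ?_
    congr 1
    funext x
    simp [hg]
  rw [SchwartzMap.toLpCLM_apply, hfg]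
  refine ((f.eLpNorm_convolution_le G hp1 hp').trans ?_).trans_lt hlt
  rw [mul_comm δ']
  gcongr
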